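/- For positive integers $m,n$ let $G(m,n)$ be the $m\times n$ grid graph, with vertices $(i,j)$, $1\le i\le m$, $1\le j\le n$, and edges $\{(i,j),(i+1,j)\}$ and $\{(i,j),(i,j+1)\}$. Let $\Delta_4(G(m,n))$ be its $4$-cut complex, that is, the simplicial complex generated by the vertex sets $F$ with $|F|=mn-4$ such that the subgraph of $G(m,n)$ induced on the complement of $F$ is disconnected. (If there is no such $F$, the complex is void, that is, it has no faces at all; otherwise the empty set is a face, of dimension $-1$.) The reduced integral simplicial homology of $\Delta_4(G(m,n))$ is torsion-free, and it vanishes in every dimension other than $mn-5$ and $mn-6$. Let $\mu=\sum_F(-1)^{\dim F}$, over all faces $F$ including the empty one, be the reduced Euler characteristic of $\Delta_4(G(m,n))$, and put $$c=\begin{cases}11n-23,&\text{if } m=2 \text{ and } n\ge 3,\\ 19mn-28(m+n)+33,&\text{if } m,n\ge 3.\end{cases}$$ In both of these cases, $c$ is the number of $4$-element vertex sets of $G(m,n)$ that induce a connected subgraph, $$(-1)^{mn-5}\mu=\binom{mn-1}{3}-c,$$ and the number of facets of $\Delta_4(G(m,n))$ is $\binom{mn}{4}-c$. -/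

import Mathlib

/-! A simplicial complex on a finite vertex set `V` is a family of finite subsets of `V` closed
under taking subsets, i.e. a `LowerSet (Finset V)`.  The empty set is a face of every complex
except the void complex `⊥`; a face `F` has dimension `|F| - 1`. -/

namespace CutComplex

section General

variable {V : Type*}

/-- The `k`-cut complex of `G`: the complex generated by the vertex sets `F` of size `|V| - k`
such that the induced subgraph on the complement of `F` is disconnected. -/
def cutComplex [Fintype V] (G : SimpleGraph V) (k : ℕ) : LowerSet (Finset V) :=
  lowerClosure {F : Finset V |
    F.card + k = Fintype.card V ∧ ¬ (G.induce ((F : Set V)ᶜ)).Connected}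

/-- The facets of a complex are its inclusion-maximal faces. -/
def facets (K : LowerSet (Finset V)) : Set (Finset V) :=
  {F | Maximal (fun F' => F' ∈ K) F}

open Classical in
/-- The reduced Euler characteristic `∑ (-1) ^ dim F`, over all faces `F`, the empty one included;
note that `(-1) ^ (|F| - 1) = (-1) ^ (|F| + 1)`. -/
noncomputable def reducedEulerChar [Fintype V] (K : LowerSet (Finset V)) : ℤ :=
  ∑ F : Finset V with F ∈ K, (-1) ^ (F.card + 1)

/-- The sets of `k` vertices that induce a connected subgraph. -/
def connectedSubsets (G : SimpleGraph V) (k : ℕ) : Set (Finset V) :=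
  {A | A.card = k ∧ (G.induce (A : Set V)).Connected}

end General

section Homology

variable {V : Type*} [LinearOrder V]

/-- The (augmented) simplicial boundary: if `v₀ < ⋯ < v_d` are the elements of `F`, then `F` is
sent to the sum of the `(-1) ^ i` times `F` with `v_i` removed. -/
noncomputable def boundary : (Finset V →₀ ℤ) →ₗ[ℤ] (Finset V →₀ ℤ) :=
  Finsupp.linearCombination ℤ fun F : Finset V =>
    ∑ v ∈ F, Finsupp.single (F.erase v) ((-1 : ℤ) ^ (F.filter (· < v)).card)

/-- Integral simplicial `d`-chains: combinations of the `d`-dimensional faces, for `d : ℤ`.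
The empty face is in dimension `-1`. -/
def chains (K : LowerSet (Finset V)) (d : ℤ) : Submodule ℤ (Finset V →₀ ℤ) :=
  Finsupp.supported ℤ ℤ {F : Finset V | F ∈ K ∧ (F.card : ℤ) = d + 1}

/-- The reduced `d`-cycles. -/
noncomputable def cycles (K : LowerSet (Finset V)) (d : ℤ) : Submodule ℤ (Finset V →₀ ℤ) :=
  chains K d ⊓ LinearMap.ker boundary

/-- The `d`-boundaries. -/
noncomputable def boundaries (K : LowerSet (Finset V)) (d : ℤ) : Submodule ℤ (Finset V →₀ ℤ) :=
  (chains K (d + 1)).map boundary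

/-- The reduced simplicial homology group of `K` in dimension `d`, with integer coefficients. -/
abbrev ReducedHomology (K : LowerSet (Finset V)) (d : ℤ) : Type _ :=
  (cycles K d) ⧸ (boundaries K d).submoduleOf (cycles K d)

theorem boundary_single (F : Finset V) (c : ℤ) :
    boundary (Finsupp.single F c) =
      c • ∑ v ∈ F, Finsupp.single (F.erase v) ((-1 : ℤ) ^ (F.filter (· < v)).card) := by
  simp [boundary]

theorem boundary_mem_chains (K : LowerSet (Finset V)) (d : ℤ) {x : Finset V →₀ ℤ}
    (hx : x ∈ chains K (d + 1)) : boundary x ∈ chains K d := by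
  rw [boundary, Finsupp.linearCombination_apply]
  refine Submodule.sum_mem _ fun F hF => Submodule.smul_mem _ _ (Submodule.sum_mem _ fun v hv => ?_)
  obtain ⟨h1, h2⟩ := (Finsupp.mem_supported _ _).1 hx hF
  refine Finsupp.single_mem_supported _ _ ⟨K.lower (Finset.erase_subset v F) h1, ?_⟩
  have := Finset.card_erase_add_one hv
  push_cast [← this] at h2
  linarith

theorem boundary_boundary (x : Finset V →₀ ℤ) : boundary (boundary x) = 0 := by
  have key : ∀ F : Finset V, boundary (boundary (Finsupp.single F (1 : ℤ))) = 0 := by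
    intro F
    simp only [boundary_single, one_smul, map_sum]
    simp only [Finset.smul_sum, Finsupp.smul_single, smul_eq_mul]
    rw [Finset.sum_sigma']
    refine Finset.sum_involution (fun p _ => ⟨p.2, p.1⟩) ?_ ?_ ?_ ?_
    · rintro ⟨v, w⟩ h
      simp only [Finset.mem_sigma, Finset.mem_erase] at h
      obtain ⟨hv, hwv, hw⟩ := h
      have e : (F.erase v).erase w = (F.erase w).erase v := Finset.erase_right_comm
      rw [e, ← Finsupp.single_add]
      have main : ∀ a b : V, a ∈ F → b ∈ F → a < b →
          (-1 : ℤ) ^ (F.filter (· < a)).card * (-1) ^ ((F.erase a).filter (· < b)).card +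
          (-1 : ℤ) ^ (F.filter (· < b)).card * (-1) ^ ((F.erase b).filter (· < a)).card = 0 := by
        intro a b ha hb hab
        have h1 : (F.erase b).filter (· < a) = F.filter (· < a) := by
          ext c; simp only [Finset.mem_filter, Finset.mem_erase]
          constructor
          · rintro ⟨⟨_, h⟩, h'⟩; exact ⟨h, h'⟩
          · rintro ⟨h, h'⟩; exact ⟨⟨(h'.trans hab).ne, h⟩, h'⟩
        have h2 : ((F.erase a).filter (· < b)) = (F.filter (· < b)).erase a := by
          ext c; simp only [Finset.mem_filter, Finset.mem_erase, and_assoc]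
        have h3 : (F.filter (· < b)).card = ((F.filter (· < b)).erase a).card + 1 :=
          (Finset.card_erase_add_one (by simp [ha, hab])).symm
        rw [h1, h2, h3]
        ring
      rcases lt_or_gt_of_ne hwv with hlt | hlt
      · rw [add_comm, main w v hw hv hlt, Finsupp.single_zero]
      · rw [main v w hv hw hlt, Finsupp.single_zero]
    · rintro ⟨v, w⟩ h _ heq
      simp only [Finset.mem_sigma, Finset.mem_erase] at h
      exact h.2.1 (by simpa using congrArg Sigma.fst heq)
    · rintro ⟨v, w⟩ h
      simp only [Finset.mem_sigma, Finset.mem_erase] at h ⊢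
      exact ⟨h.2.2, h.2.1.symm, h.1⟩
    · rintro ⟨v, w⟩ _
      rfl
  have : boundary ∘ₗ boundary = (0 : (Finset V →₀ ℤ) →ₗ[ℤ] (Finset V →₀ ℤ)) := by
    refine Finsupp.lhom_ext' fun F => LinearMap.ext_ring ?_
    simpa using key F
  exact LinearMap.congr_fun this x

theorem boundaries_le_cycles (K : LowerSet (Finset V)) (d : ℤ) :
    boundaries K d ≤ cycles K d := by
  rintro _ ⟨x, hx, rfl⟩
  exact ⟨boundary_mem_chains K d hx, boundary_boundary x⟩

end Homology

/-- The `m` by `n` grid graph: `(i, j)` and `(i', j')` are adjacent when they agree in one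
coordinate and differ by one in the other.  The vertices carry the lexicographic order, which is
used only to orient the simplices. -/
def gridGraph (m n : ℕ) : SimpleGraph (Fin m ×ₗ Fin n) :=
  (SimpleGraph.pathGraph m □ SimpleGraph.pathGraph n).comap ofLex

end CutComplex

open CutComplex

/-! Among any five cells of the grid some four induce a disconnected subgraph. Hence the faces are
exactly the sets whose complement has at least five elements, together with those whose complement
is a disconnected 4-set (`mem_cutComplex_iff`): a full skeleton of the simplex on all vertices with
some faces of dimension mn-5 added. The missing faces have as complements the sets of at most three
vertices and the connected 4-sets, so the facet count and the Euler characteristic reduce to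
counting the latter.

In dimension mn-5 there are no chains above, so homology is the group of cycles, which is
torsion-free. In all other dimensions homology vanishes, even in mn-6. Below the top, a cycle bounds
in the full simplex by coning, and the cone must be pushed into the complex modulo boundaries. A
missing face with connected complement A is traded, through the boundary of its join with a suitable
t in A, for faces with complements A - t + v. These are disconnected or have smaller rank, so the
process ends (`single_mem_chains_sup_range_boundary`).

What remains is about the 19 fixed tetrominoes: the connected 4-sets are their translates, and the
five-cell property and the exchange step are finite checks on them. Counting translates by bounding
box gives c. -/

namespace CutComplex

/-! ### Cut complexes of arbitrary graphs: facets, faces and Euler characteristic. -/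

section General

variable {V : Type*} [Fintype V]

/-- The generators all have the same cardinality, so none contains another. -/
theorem facets_cutComplex (G : SimpleGraph V) (k : ℕ) :
    facets (cutComplex G k) = {F : Finset V |
      F.card + k = Fintype.card V ∧ ¬ (G.induce ((F : Set V)ᶜ)).Connected} := by
  ext F
  constructor
  · rintro ⟨⟨F', hF', hle⟩, hmax⟩
    have : F' ≤ F := hmax (subset_lowerClosure hF') hle
    rwa [le_antisymm hle this]
  · intro hF
    refine ⟨subset_lowerClosure hF, ?_⟩
    rintro F' ⟨F'', hF'', hle'⟩ hle
    have h1 := hF.1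
    have h2 := hF''.1
    have : F = F'' := Finset.eq_of_subset_of_card_le (hle.trans hle') (by omega)
    rw [this]
    exact hle'

variable [DecidableEq V]

theorem ncard_facets_cutComplex (G : SimpleGraph V) (k : ℕ) :
    ((facets (cutComplex G k)).ncard : ℤ) =
      ((Fintype.card V).choose k : ℤ) - (connectedSubsets G k).ncard := by
  have h1 : facets (cutComplex G k) =
      compl '' (((Finset.univ : Finset V).powersetCard k : Set (Finset V)) \
        connectedSubsets G k) := by
    rw [facets_cutComplex]
    ext F
    simp only [Set.mem_ofPred_eq, Set.mem_image, Set.mem_sdiff, Finset.mem_coe,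
      Finset.mem_powersetCard_univ, connectedSubsets, not_and]
    have hc := Finset.card_add_card_compl F
    constructor
    · rintro ⟨h, h'⟩
      refine ⟨Fᶜ, ⟨by omega, fun _ => ?_⟩, compl_compl F⟩
      rwa [Finset.coe_compl]
    · rintro ⟨A, ⟨hA, hA'⟩, rfl⟩
      refine ⟨by rw [← hA, add_comm]; exact Finset.card_add_card_compl A, ?_⟩
      rw [Finset.coe_compl, compl_compl]
      exact hA' hA
  have h2 : connectedSubsets G k ⊆ ((Finset.univ : Finset V).powersetCard k : Set (Finset V)) := by
    intro A hA
    simpa using hA.1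
  rw [h1, Set.ncard_image_of_injective _ compl_injective, Set.ncard_sdiff h2,
    Set.ncard_coe_finset, Finset.card_powersetCard, Finset.card_univ, Nat.cast_sub]
  have := Set.ncard_le_ncard h2
  rwa [Set.ncard_coe_finset, Finset.card_powersetCard, Finset.card_univ] at this

/-- Under `hG` a complement with more than k elements contains a disconnected k-set, whose
complement is a facet above F. Only complements of size exactly k need inspection. -/
theorem mem_cutComplex_iff {G : SimpleGraph V} {k : ℕ}
    (hG : ∀ B : Finset V, B.card = k + 1 →
      ∃ A ⊆ B, A.card = k ∧ ¬ (G.induce (A : Set V)).Connected) (F : Finset V) :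
    F ∈ cutComplex G k ↔ k < Fᶜ.card ∨ (Fᶜ.card = k ∧ Fᶜ ∉ connectedSubsets G k) := by
  have hc := Finset.card_add_card_compl F
  constructor
  · rintro ⟨F', ⟨h1, h2⟩, hle⟩
    have hcard : F.card ≤ F'.card := Finset.card_le_card hle
    rcases hcard.lt_or_eq with hlt | heq
    · left; omega
    · right
      have : F = F' := Finset.eq_of_subset_of_card_le hle heq.ge
      subst this
      refine ⟨by omega, fun h => h2 ?_⟩
      have := h.2
      rwa [Finset.coe_compl] at this
  · rintro (h | ⟨h, h'⟩)
    · obtain ⟨B, hB, hBc⟩ := Finset.exists_subset_card_eq (show k + 1 ≤ Fᶜ.card from h)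
      obtain ⟨A, hA, hAc, hAn⟩ := hG B hBc
      refine ⟨Aᶜ, ⟨?_, by rwa [Finset.coe_compl, compl_compl]⟩, ?_⟩
      · rw [← hAc, add_comm]; exact Finset.card_add_card_compl A
      · exact Finset.subset_compl_comm.1 (hA.trans hB)
    · refine subset_lowerClosure ⟨by omega, fun hcon => h' ⟨h, ?_⟩⟩
      rwa [Finset.coe_compl]

/-- The signed sum over all subsets of V is zero, so the Euler characteristic is minus the sum over
non-faces. Cut size k + 1 makes k the index of the binomial coefficient. -/
theorem reducedEulerChar_cutComplex {G : SimpleGraph V} {k : ℕ}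
    (hG : ∀ B : Finset V, B.card = (k + 1) + 1 →
      ∃ A ⊆ B, A.card = k + 1 ∧ ¬ (G.induce (A : Set V)).Connected)
    (hk : k + 2 ≤ Fintype.card V) :
    (-1 : ℤ) ^ (Fintype.card V - (k + 2)) * reducedEulerChar (cutComplex G (k + 1)) =
      ((Fintype.card V - 1).choose k : ℤ) - (connectedSubsets G (k + 1)).ncard := by
  classical
  obtain ⟨N, hN⟩ : ∃ N, Fintype.card V = N + (k + 2) := ⟨_, (Nat.sub_add_cancel hk).symm⟩
  have hne : (Finset.univ : Finset V).Nonempty := by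
    rw [← Finset.card_pos, Finset.card_univ]; omega
  have hall : ∑ F : Finset V, (-1 : ℤ) ^ (F.card + 1) = 0 := by
    have := Finset.sum_powerset_neg_one_pow_card_of_nonempty hne
    rw [Finset.powerset_univ] at this
    simp [pow_succ, this]
  have hsplit := Finset.sum_filter_add_sum_filter_not (Finset.univ : Finset (Finset V))
    (fun F => F ∈ cutComplex G (k + 1)) (fun F => (-1 : ℤ) ^ (F.card + 1))
  rw [hall] at hsplit
  have hnon : ∑ F : Finset V with ¬ F ∈ cutComplex G (k + 1), (-1 : ℤ) ^ (F.card + 1) =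
      ∑ A : Finset V with A.card < k + 1 ∨ A ∈ connectedSubsets G (k + 1),
        (-1 : ℤ) ^ (N + k + 1 + A.card) := by
    refine Finset.sum_bij (fun F _ => Fᶜ) ?_ (fun _ _ _ _ h => compl_injective h) ?_ ?_
    · intro F hF
      simp only [Finset.mem_filter, Finset.mem_univ, true_and, mem_cutComplex_iff hG, not_or,
        not_and, not_not, not_lt] at hF ⊢
      rcases hF.1.lt_or_eq with h | h
      · exact Or.inl h
      · exact Or.inr (hF.2 h)
    · intro A hA
      refine ⟨Aᶜ, ?_, compl_compl A⟩
      simp only [Finset.mem_filter, Finset.mem_univ, true_and, mem_cutComplex_iff hG, not_or,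
        not_and, not_not, not_lt, compl_compl] at hA ⊢
      rcases hA with h | h
      · exact ⟨h.le, fun h' => absurd h' h.ne⟩
      · exact ⟨h.1.le, fun _ => h⟩
    · intro F _
      -- Both exponents have the same parity, because |F| + |Fᶜ| = N + k + 2.
      have hc := Finset.card_add_card_compl F
      rw [neg_one_pow_eq_pow_mod_two, neg_one_pow_eq_pow_mod_two (n := N + k + 1 + _)]
      congr 1
      omega
  have hdisj : Disjoint (Finset.univ.filter fun A : Finset V => A.card < k + 1)
      (Finset.univ.filter fun A : Finset V => A ∈ connectedSubsets G (k + 1)) := by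
    rw [Finset.disjoint_filter]
    intro A _ h h'
    exact h.ne h'.1
  have hsmall : ∑ A : Finset V with A.card < k + 1, (-1 : ℤ) ^ A.card =
      (-1) ^ k * ((Fintype.card V - 1).choose k : ℤ) := by
    -- A truncated alternating sum of binomial coefficients is a single signed one.
    rw [← Int.alternating_sum_range_choose_eq_choose]
    rw [show Fintype.card V - 1 + 1 = Fintype.card V by omega]
    rw [← Finset.sum_fiberwise_of_maps_to
      (s := Finset.univ.filter fun A : Finset V => A.card < k + 1)
      (t := Finset.range (k + 1)) (g := Finset.card) (by simp)]
    refine Finset.sum_congr rfl fun j hj => ?_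
    rw [Finset.sum_congr rfl (g := fun _ => (-1 : ℤ) ^ j) (by
      intro A hA; rw [(Finset.mem_filter.1 hA).2])]
    rw [Finset.sum_const, nsmul_eq_mul, mul_comm]
    congr 2
    rw [← Finset.card_univ, ← Finset.card_powersetCard]
    congr 1
    ext A
    simp only [Finset.mem_filter, Finset.mem_univ, true_and, Finset.mem_powersetCard_univ,
      Finset.mem_range] at hj ⊢
    omega
  have hconn : ∑ A : Finset V with A ∈ connectedSubsets G (k + 1), (-1 : ℤ) ^ A.card =
      (-1) ^ (k + 1) * ((connectedSubsets G (k + 1)).ncard : ℤ) := by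
    rw [Finset.sum_congr rfl (g := fun _ => (-1 : ℤ) ^ (k + 1)) (by
      intro A hA; rw [(Finset.mem_filter.1 hA).2.1])]
    rw [Finset.sum_const, nsmul_eq_mul, mul_comm, ← Set.ncard_coe_finset]
    congr 3
    ext A
    simp
  have hsum : ∑ A : Finset V with A.card < k + 1 ∨ A ∈ connectedSubsets G (k + 1),
      (-1 : ℤ) ^ (N + k + 1 + A.card) = (-1) ^ (N + k + 1) *
        ((-1) ^ k * ((Fintype.card V - 1).choose k : ℤ) +
          (-1) ^ (k + 1) * ((connectedSubsets G (k + 1)).ncard : ℤ)) := by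
    rw [← hsmall, ← hconn, ← Finset.sum_union hdisj, ← Finset.filter_or, Finset.mul_sum]
    exact Finset.sum_congr rfl fun A _ => pow_add _ _ _
  rw [hnon, hsum] at hsplit
  have hμ := eq_neg_of_add_eq_zero_left hsplit
  unfold reducedEulerChar
  rw [hμ, show Fintype.card V - (k + 2) = N by omega]
  have e1 : (-1 : ℤ) ^ N * (-1) ^ N = 1 := by rw [← mul_pow]; simp
  have e2 : (-1 : ℤ) ^ k * (-1) ^ k = 1 := by rw [← mul_pow]; simp
  simp only [pow_succ, pow_add]
  linear_combination (((Fintype.card V - 1).choose k : ℤ) -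
    ((connectedSubsets G (k + 1)).ncard : ℤ)) * (-1 : ℤ) ^ k * (-1 : ℤ) ^ k * e1 +
    (((Fintype.card V - 1).choose k : ℤ) - ((connectedSubsets G (k + 1)).ncard : ℤ)) * e2

end General

/-! ### Vanishing and torsion-freeness of homology from an exchange property. -/

section Homology

variable {V : Type*} [LinearOrder V]

/-- The cone operator with apex `a`: a face not containing `a` is sent to its join with `a`. -/
noncomputable def cone (a : V) : (Finset V →₀ ℤ) →ₗ[ℤ] (Finset V →₀ ℤ) :=
  Finsupp.linearCombination ℤ fun F : Finset V =>
    if a ∈ F then 0 else Finsupp.single (insert a F) 1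

theorem cone_single (a : V) (F : Finset V) (c : ℤ) :
    cone a (Finsupp.single F c) = if a ∈ F then 0 else Finsupp.single (insert a F) c := by
  rw [cone, Finsupp.linearCombination_single]
  split_ifs <;> simp

/-- The apex is the least vertex, so deleting it carries sign +1 and inserting it flips every other
sign; no further signs are needed in `cone`. -/
theorem boundary_cone_add_cone_boundary {a : V} (ha : ∀ v, a ≤ v) (x : Finset V →₀ ℤ) :
    boundary (cone a x) + cone a (boundary x) = x := by
  have key : ∀ F : Finset V, boundary (cone a (Finsupp.single F (1 : ℤ))) +
      cone a (boundary (Finsupp.single F (1 : ℤ))) = Finsupp.single F 1 := by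
    intro F
    have hmin : ∀ H : Finset V, H.filter (· < a) = ∅ := fun H =>
      Finset.filter_eq_empty_iff.2 fun v _ => (ha v).not_gt
    by_cases haF : a ∈ F
    · rw [cone_single, if_pos haF, map_zero, zero_add, boundary_single, one_smul, map_sum,
        Finset.sum_eq_single_of_mem a haF]
      · rw [cone_single, if_neg (Finset.notMem_erase a F), Finset.insert_erase haF, hmin]
        simp
      · intro v _ hva
        rw [cone_single, if_pos (Finset.mem_erase.2 ⟨hva.symm, haF⟩)]
    · rw [cone_single, if_neg haF, boundary_single, boundary_single, one_smul, one_smul,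
        Finset.sum_insert haF, Finset.erase_insert haF, hmin, map_sum, add_assoc,
        ← Finset.sum_add_distrib, Finset.sum_eq_zero]
      · simp
      · intro v hv
        have hva : a ≠ v := fun h => haF (h ▸ hv)
        rw [cone_single, if_neg (fun h => haF (Finset.mem_of_mem_erase h)),
          Finset.erase_insert_of_ne hva, ← Finsupp.single_add, Finset.filter_insert,
          if_pos (lt_of_le_of_ne (ha v) hva),
          Finset.card_insert_of_notMem (fun h => haF (Finset.mem_filter.1 h).1)]
        simp [pow_succ]
  have : boundary ∘ₗ cone a + cone a ∘ₗ boundary = LinearMap.id := by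
    refine Finsupp.lhom_ext' fun F => LinearMap.ext_ring ?_
    simpa using key F
  exact LinearMap.congr_fun this x

theorem cone_mem_chains_top (a : V) (d : ℤ) {x : Finset V →₀ ℤ} (hx : x ∈ chains ⊤ d) :
    cone a x ∈ chains ⊤ (d + 1) := by
  rw [cone, Finsupp.linearCombination_apply]
  refine Submodule.sum_mem _ fun F hF => Submodule.smul_mem _ _ ?_
  obtain ⟨-, h2⟩ := (Finsupp.mem_supported _ _).1 hx hF
  split_ifs with haF
  · exact Submodule.zero_mem _
  · refine Finsupp.single_mem_supported _ _ ⟨trivial, ?_⟩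
    rw [Finset.card_insert_of_notMem haF]
    push_cast
    rw [h2]

theorem subsingleton_reducedHomology {K : LowerSet (Finset V)} {d : ℤ}
    (h : cycles K d ≤ boundaries K d) : Subsingleton (ReducedHomology K d) :=
  Submodule.Quotient.subsingleton_iff.2 (Submodule.submoduleOf_eq_top.2 h)

/-- Without chains one dimension up, homology is the cycle group, a subgroup of a free abelian
group. -/
theorem isTorsionFree_reducedHomology {K : LowerSet (Finset V)} {d : ℤ}
    (h : chains K (d + 1) = ⊥) : Module.IsTorsionFree ℤ (ReducedHomology K d) := by
  have hb : (boundaries K d).submoduleOf (cycles K d) = ⊥ := by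
    rw [boundaries, h, Submodule.map_bot, Submodule.submoduleOf, Submodule.comap_bot,
      Submodule.ker_subtype]
  have e := Submodule.quotEquivOfEqBot _ hb
  exact e.injective.moduleIsTorsionFree e (by simp)

variable [Fintype V]

theorem chains_cutComplex_eq_bot {G : SimpleGraph V} {k : ℕ}
    (hG : ∀ B : Finset V, B.card = k + 1 →
      ∃ A ⊆ B, A.card = k ∧ ¬ (G.induce (A : Set V)).Connected) {d : ℤ}
    (hd : (Fintype.card V : ℤ) - (k + 1) < d) : chains (cutComplex G k) d = ⊥ := by
  have hempty : {F : Finset V | F ∈ cutComplex G k ∧ (F.card : ℤ) = d + 1} = ∅ := by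
    ext F
    simp only [Set.mem_ofPred_eq, mem_cutComplex_iff hG, Set.mem_empty_iff_false, iff_false,
      not_and]
    have hc := Finset.card_add_card_compl F
    rintro h h'
    omega
  rw [chains, hempty, Finsupp.supported_empty]

/-- Strong induction on the rank r of the complement. In the boundary of F + t, the term F has
coefficient ±1 and every other term has complement Fᶜ - t + v: in the complex if disconnected,
covered by induction otherwise. -/
theorem single_mem_chains_sup_range_boundary {G : SimpleGraph V} {k : ℕ} (r : Finset V → ℕ)
    (hG : ∀ B : Finset V, B.card = k + 1 →
      ∃ A ⊆ B, A.card = k ∧ ¬ (G.induce (A : Set V)).Connected)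
    (hr : ∀ A ∈ connectedSubsets G k, ∃ t ∈ A, ∀ v ∉ A,
      insert v (A.erase t) ∈ connectedSubsets G k → r (insert v (A.erase t)) < r A)
    (F : Finset V) (d : ℤ) (hF : Fᶜ.card = k) (hd : (F.card : ℤ) = d + 1) :
    Finsupp.single F (1 : ℤ) ∈ chains (cutComplex G k) d ⊔ (chains ⊤ (d + 1)).map boundary := by
  induction hn : r Fᶜ using Nat.strong_induction_on generalizing F with
  | _ n ih =>
  by_cases hcon : Fᶜ ∈ connectedSubsets G k
  · obtain ⟨t, ht, hlt⟩ := hr _ hcon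
    have htF : t ∉ F := Finset.mem_compl.1 ht
    have hb : boundary (Finsupp.single (insert t F) (1 : ℤ)) ∈
        (chains (⊤ : LowerSet (Finset V)) (d + 1)).map boundary := by
      refine Submodule.mem_map_of_mem (Finsupp.single_mem_supported _ _ ⟨trivial, ?_⟩)
      rw [Finset.card_insert_of_notMem htF]
      push_cast
      rw [hd]
    have hb' := Submodule.mem_sup_right (S := chains (cutComplex G k) d) hb
    rw [boundary_single, one_smul, Finset.sum_insert htF, Finset.erase_insert htF] at hb'
    have hrest : ∑ v ∈ F, Finsupp.single ((insert t F).erase v)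
        ((-1 : ℤ) ^ ((insert t F).filter (· < v)).card) ∈
        chains (cutComplex G k) d ⊔ (chains ⊤ (d + 1)).map boundary := by
      refine Submodule.sum_mem _ fun v hv => ?_
      rw [← mul_one ((-1 : ℤ) ^ _), ← smul_eq_mul, ← Finsupp.smul_single]
      refine Submodule.smul_mem _ _ ?_
      have hvt : t ≠ v := fun h => htF (h ▸ hv)
      have hcompl : ((insert t F).erase v)ᶜ = insert v (Fᶜ.erase t) := by
        rw [Finset.compl_erase, Finset.compl_insert]
      have hcard : ((insert t F).erase v).card = F.card := by
        rw [Finset.card_erase_of_mem (Finset.mem_insert_of_mem hv),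
          Finset.card_insert_of_notMem htF]
        simp
      have hcard' : ((insert t F).erase v)ᶜ.card = k := by
        rw [Finset.card_compl, hcard, ← Finset.card_compl, hF]
      by_cases hcon' : insert v (Fᶜ.erase t) ∈ connectedSubsets G k
      · refine ih _ ?_ _ hcard' (by rw [hcard, hd]) rfl
        rw [← hn, hcompl]
        exact hlt v (by simpa using hv) hcon'
      · refine Submodule.mem_sup_left (Finsupp.single_mem_supported _ _ ⟨?_, by rw [hcard, hd]⟩)
        rw [mem_cutComplex_iff hG]
        exact Or.inr ⟨hcard', by rwa [hcompl]⟩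
    -- Multiplying by the sign of F once more clears it, since its square is 1.
    have hmain := Submodule.smul_mem _ ((-1 : ℤ) ^ ((insert t F).filter (· < t)).card)
      ((Submodule.add_mem_iff_left _ hrest).1 hb')
    rwa [Finsupp.smul_single, smul_eq_mul, ← mul_pow, neg_one_mul, neg_neg, one_pow] at hmain
  · refine Submodule.mem_sup_left (Finsupp.single_mem_supported _ _ ⟨?_, hd⟩)
    rw [mem_cutComplex_iff hG]
    exact Or.inr ⟨hF, hcon⟩

theorem cycles_le_boundaries_cutComplex {G : SimpleGraph V} {k : ℕ} (r : Finset V → ℕ)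
    [Nonempty V]
    (hG : ∀ B : Finset V, B.card = k + 1 →
      ∃ A ⊆ B, A.card = k ∧ ¬ (G.induce (A : Set V)).Connected)
    (hr : ∀ A ∈ connectedSubsets G k, ∃ t ∈ A, ∀ v ∉ A,
      insert v (A.erase t) ∈ connectedSubsets G k → r (insert v (A.erase t)) < r A)
    (d : ℤ) (hd : d ≠ (Fintype.card V : ℤ) - (k + 1)) :
    cycles (cutComplex G k) d ≤ boundaries (cutComplex G k) d := by
  rintro x ⟨hx, hker⟩
  rcases lt_or_gt_of_ne hd with hlt | hgt
  · obtain ⟨a, ha⟩ := Finite.exists_min (id : V → V)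
    have hx' : x ∈ chains ⊤ d := by
      refine Finsupp.supported_mono ?_ hx
      exact fun F hF => ⟨trivial, hF.2⟩
    have hy := cone_mem_chains_top a d hx'
    have hxy : boundary (cone a x) = x := by
      have := boundary_cone_add_cone_boundary ha x
      rwa [LinearMap.mem_ker.1 hker, map_zero, add_zero] at this
    -- The cone lies only in the full simplex. Changing it by a boundary does not change its own
    -- boundary, so a representative inside the complex suffices.
    have hsup : chains (⊤ : LowerSet (Finset V)) (d + 1) ≤
        chains (cutComplex G k) (d + 1) ⊔ (chains ⊤ (d + 1 + 1)).map boundary := by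
      rw [chains, Finsupp.supported_eq_span_single, Submodule.span_le]
      rintro _ ⟨F, ⟨-, hF⟩, rfl⟩
      have hc := Finset.card_add_card_compl F
      rcases lt_or_ge k Fᶜ.card with h | h
      · refine Submodule.mem_sup_left (Finsupp.single_mem_supported _ _ ⟨?_, hF⟩)
        rw [mem_cutComplex_iff hG]
        exact Or.inl h
      · exact single_mem_chains_sup_range_boundary r hG hr F (d + 1) (by omega) hF
    obtain ⟨y, hy', _, ⟨u, -, rfl⟩, hsum⟩ := Submodule.mem_sup.1 (hsup hy)
    refine ⟨y, hy', ?_⟩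
    rw [← hxy, ← hsum, map_add, boundary_boundary, add_zero]
  · rw [chains_cutComplex_eq_bot hG hgt] at hx
    rw [(Submodule.mem_bot ℤ).1 hx]
    exact Submodule.zero_mem _

end Homology

end CutComplex

namespace CutComplex

/-! ### Fixed tetrominoes in the infinite square grid. -/

section Tetromino

/-- Adjacency in the infinite square grid. -/
def gridAdj (x y : ℤ × ℤ) : Prop := (x.1 - y.1).natAbs + (x.2 - y.2).natAbs = 1

instance : DecidableRel gridAdj := fun x y => by unfold gridAdj; infer_instance

/-- The four neighbours of the origin. -/
def unitSteps : Finset (ℤ × ℤ) := {(1, 0), (-1, 0), (0, 1), (0, -1)}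

/-- The points that are nonnegative in the lexicographic order. -/
def LexNonneg (x : ℤ × ℤ) : Prop := 0 < x.1 ∨ x.1 = 0 ∧ 0 ≤ x.2

instance : DecidablePred LexNonneg := fun x => by unfold LexNonneg; infer_instance

/-- The fixed tetrominoes, each with the origin as its lexicographically least cell. -/
def tetrominoList : List (Finset (ℤ × ℤ)) :=
  [{(0, 0), (0, 1), (0, 2), (0, 3)},
   {(0, 0), (0, 1), (0, 2), (1, 0)},
   {(0, 0), (0, 1), (0, 2), (1, 1)},
   {(0, 0), (0, 1), (0, 2), (1, 2)},
   {(0, 0), (0, 1), (1, -1), (1, 0)},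
   {(0, 0), (0, 1), (1, 0), (1, 1)},
   {(0, 0), (0, 1), (1, 0), (2, 0)},
   {(0, 0), (0, 1), (1, 1), (1, 2)},
   {(0, 0), (0, 1), (1, 1), (2, 1)},
   {(0, 0), (1, -2), (1, -1), (1, 0)},
   {(0, 0), (1, -1), (1, 0), (1, 1)},
   {(0, 0), (1, -1), (1, 0), (2, -1)},
   {(0, 0), (1, -1), (1, 0), (2, 0)},
   {(0, 0), (1, 0), (1, 1), (1, 2)},
   {(0, 0), (1, 0), (1, 1), (2, 0)},
   {(0, 0), (1, 0), (1, 1), (2, 1)},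
   {(0, 0), (1, 0), (2, -1), (2, 0)},
   {(0, 0), (1, 0), (2, 0), (2, 1)},
   {(0, 0), (1, 0), (2, 0), (3, 0)}]

/-- The set of the fixed tetrominoes. -/
def tetrominoes : Finset (Finset (ℤ × ℤ)) := tetrominoList.toFinset

/-- The translate of `T` by `p`. -/
def shift (p : ℤ × ℤ) (T : Finset (ℤ × ℤ)) : Finset (ℤ × ℤ) := T.map (addLeftEmbedding p)

/-- A translate of one of the fixed tetrominoes. -/
def IsTetromino (B : Finset (ℤ × ℤ)) : Prop := ∃ p, ∃ T ∈ tetrominoes, B = shift p T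

/-- The relation `r` leads out of every proper nonempty subset of `B`. -/
def CutConnected {α : Type*} (r : α → α → Prop) (B : Finset α) : Prop :=
  ∀ S ⊆ B, S.Nonempty → S ≠ B → ∃ x ∈ S, ∃ y ∈ B, y ∉ S ∧ r x y

/-- The sum of `f` over the differences of the pairs of cells of `B`. -/
def pairSum (f : ℤ × ℤ → ℕ) (B : Finset (ℤ × ℤ)) : ℕ := ∑ x ∈ B, ∑ y ∈ B, f (x - y)

/-- The indicator of the neighbours of the origin. -/
def adjWeight (x : ℤ × ℤ) : ℕ := if x.1.natAbs + x.2.natAbs = 1 then 1 else 0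

/-- Counts the neighbours of the origin twice and its diagonal neighbours once. -/
def kingWeight (x : ℤ × ℤ) : ℕ :=
  if x.1.natAbs + x.2.natAbs = 1 then 2 else if x.1.natAbs = 1 ∧ x.2.natAbs = 1 then 1 else 0

theorem nodup_tetrominoList : tetrominoList.Nodup := by decide +kernel

theorem card_of_mem_tetrominoes : ∀ T ∈ tetrominoes, T.card = 4 := by decide +kernel

theorem zero_mem_of_mem_tetrominoes : ∀ T ∈ tetrominoes, (0 : ℤ × ℤ) ∈ T := by decide +kernel

theorem lexNonneg_of_mem_tetrominoes : ∀ T ∈ tetrominoes, ∀ x ∈ T, LexNonneg x := by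
  decide +kernel

/-- Completeness of the list: a connected 4-set with lexicographic minimum at the origin grows from
it by adding one neighbouring cell at a time. -/
theorem growth_mem_tetrominoes : ∀ a ∈ unitSteps, LexNonneg a →
    ∀ u ∈ ({0, a} : Finset (ℤ × ℤ)), ∀ b ∈ unitSteps, LexNonneg (u + b) →
    ∀ v ∈ ({0, a, u + b} : Finset (ℤ × ℤ)), ∀ c ∈ unitSteps, LexNonneg (v + c) →
    ({0, a, u + b, v + c} : Finset (ℤ × ℤ)).card = 4 →
    ({0, a, u + b, v + c} : Finset (ℤ × ℤ)) ∈ tetrominoes := by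
  decide +kernel

theorem cutConnected_of_mem_tetrominoes : ∀ T ∈ tetrominoes, CutConnected gridAdj T := by
  have h : ∀ T ∈ tetrominoes, ∀ S ∈ T.powerset, S.Nonempty → S ≠ T →
      ∃ x ∈ S, ∃ y ∈ T, y ∉ S ∧ gridAdj x y := by
    decide +kernel
  exact fun T hT S hS => h T hT S (Finset.mem_powerset.2 hS)

/-- Four connected cells span at least three edges, each counted in both orders. The bound serves
below as a cheap necessary test for connectedness. -/
theorem pairSum_adjWeight_of_mem_tetrominoes : ∀ T ∈ tetrominoes, 6 ≤ pairSum adjWeight T := by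
  decide +kernel

/-- In the I, L and T shapes some cut cell has no substitute. In the S shape a middle cell can only
be replaced so as to give an L, which has fewer diagonal contacts. The square has the largest
weight, and no other cell completes it after a removal. -/
theorem exists_exchange_of_mem_tetrominoes : ∀ T ∈ tetrominoes, ∃ t ∈ T, ∀ u ∈ T.erase t,
    ∀ e ∈ unitSteps, u + e ∉ T →
      6 ≤ pairSum adjWeight (insert (u + e) (T.erase t)) →
        pairSum kingWeight (insert (u + e) (T.erase t)) < pairSum kingWeight T := by
  decide +kernel

/-- Five connected cells always have a cut cell: a 2-connected bipartite graph on five vertices is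
K_{2,3}, but two grid cells have at most two common neighbours. The added cell is no cut cell, as T
is connected. -/
theorem exists_erase_of_mem_tetrominoes : ∀ T ∈ tetrominoes, ∀ u ∈ T, ∀ e ∈ unitSteps,
    u + e ∉ T → ∃ t ∈ T, pairSum adjWeight (insert (u + e) (T.erase t)) < 6 := by
  decide +kernel

/-- Each pair is the bounding box of a tetromino, less one in each direction. -/
theorem extents_tetrominoList :
    tetrominoList.map (fun T => (T.sup fun x => x.1.toNat,
      (T.sup fun x => (-x.2).toNat) + T.sup fun x => x.2.toNat)) =
    [(0, 3), (1, 2), (1, 2), (1, 2), (1, 2), (1, 1), (2, 1), (1, 2), (2, 1), (1, 2), (1, 2),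
      (2, 1), (2, 1), (1, 2), (2, 1), (2, 1), (2, 1), (2, 1), (3, 0)] := by
  decide +kernel

theorem mem_shift {p x : ℤ × ℤ} {T : Finset (ℤ × ℤ)} : x ∈ shift p T ↔ x - p ∈ T := by
  simp only [shift, Finset.mem_map, addLeftEmbedding_apply]
  exact ⟨by rintro ⟨t, ht, rfl⟩; simpa using ht, fun h => ⟨_, h, by simp⟩⟩

theorem pairSum_shift (f : ℤ × ℤ → ℕ) (p : ℤ × ℤ) (T : Finset (ℤ × ℤ)) :
    pairSum f (shift p T) = pairSum f T := by
  simp [pairSum, shift]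

theorem cutConnected_map {α β : Type*} {r : α → α → Prop} {s : β → β → Prop} (f : α ↪ β)
    (h : ∀ x y, s (f x) (f y) ↔ r x y) (B : Finset α) :
    CutConnected s (B.map f) ↔ CutConnected r B := by
  constructor
  · intro hB S hS hne hSB
    obtain ⟨x, hx, y, hy, hyS, hxy⟩ := hB (S.map f) (Finset.map_subset_map.2 hS)
      (hne.map) (fun h => hSB (Finset.map_injective f h))
    obtain ⟨x, hx', rfl⟩ := Finset.mem_map.1 hx
    obtain ⟨y, hy', rfl⟩ := Finset.mem_map.1 hy
    exact ⟨x, hx', y, hy', fun h => hyS (Finset.mem_map_of_mem f h), (h x y).1 hxy⟩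
  · intro hB S hS hne hSB
    obtain ⟨S, hS', rfl⟩ := Finset.subset_map_iff.1 hS
    obtain ⟨x, hx, y, hy, hyS, hxy⟩ := hB S hS' (Finset.map_nonempty.1 hne)
      (fun h => hSB (by rw [h]))
    refine ⟨f x, Finset.mem_map_of_mem f hx, f y, Finset.mem_map_of_mem f hy, ?_, (h x y).2 hxy⟩
    simpa using hyS

theorem IsTetromino.card_eq {B : Finset (ℤ × ℤ)} (hB : IsTetromino B) : B.card = 4 := by
  obtain ⟨p, T, hT, rfl⟩ := hB
  rw [shift, Finset.card_map, card_of_mem_tetrominoes T hT]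

theorem IsTetromino.cutConnected {B : Finset (ℤ × ℤ)} (hB : IsTetromino B) :
    CutConnected gridAdj B := by
  obtain ⟨p, T, hT, rfl⟩ := hB
  exact (cutConnected_map _ (by simp [gridAdj]) T).2 (cutConnected_of_mem_tetrominoes T hT)

theorem IsTetromino.six_le_pairSum {B : Finset (ℤ × ℤ)} (hB : IsTetromino B) :
    6 ≤ pairSum adjWeight B := by
  obtain ⟨p, T, hT, rfl⟩ := hB
  rw [pairSum_shift]
  exact pairSum_adjWeight_of_mem_tetrominoes T hT

theorem gridAdj.exists_step {x y : ℤ × ℤ} (h : gridAdj x y) : ∃ e ∈ unitSteps, y = x + e := by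
  refine ⟨y - x, ?_, by simp⟩
  obtain ⟨a, b⟩ := x
  obtain ⟨c, d⟩ := y
  simp only [gridAdj, unitSteps, Finset.mem_insert, Finset.mem_singleton, Prod.mk_sub_mk,
    Prod.mk.injEq] at h ⊢
  omega

theorem gridAdj.symm {x y : ℤ × ℤ} (h : gridAdj x y) : gridAdj y x := by
  unfold gridAdj at *
  omega

theorem isTetromino_of_cutConnected {B : Finset (ℤ × ℤ)} (hcard : B.card = 4)
    (hB : CutConnected gridAdj B) : IsTetromino B := by
  have hne : B.Nonempty := Finset.card_pos.1 (by omega)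
  obtain ⟨p, hp, hmin⟩ := B.exists_min_image (fun x => toLex x) hne
  -- Coordinates are taken relative to p, the lexicographically least cell of B.
  have hlex : ∀ x, p + x ∈ B → LexNonneg x := by
    intro x hx
    have := hmin _ hx
    rw [Prod.Lex.toLex_le_toLex] at this
    simp only [Prod.fst_add, Prod.snd_add] at this
    unfold LexNonneg
    omega
  have grow : ∀ S : Finset (ℤ × ℤ), S.Nonempty → shift p S ⊆ B → S.card < 4 →
      ∃ u ∈ S, ∃ e ∈ unitSteps, LexNonneg (u + e) ∧ p + (u + e) ∈ B ∧ u + e ∉ S := by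
    intro S hS hSB hlt
    obtain ⟨x, hx, y, hy, hyS, hxy⟩ := hB (shift p S) hSB hS.map (by
      intro h
      rw [← h, shift, Finset.card_map] at hcard
      omega)
    obtain ⟨e, he, rfl⟩ := hxy.exists_step
    have e1 : p + (x - p + e) = x + e := by abel
    refine ⟨x - p, mem_shift.1 hx, e, he, hlex _ (by rwa [e1]), by rwa [e1], fun h => hyS ?_⟩
    rw [mem_shift]
    convert h using 1
    abel
  have hsub : ∀ (S : Finset (ℤ × ℤ)) (x : ℤ × ℤ), shift p S ⊆ B → p + x ∈ B →
      shift p (insert x S) ⊆ B := by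
    intro S x hS hx
    rw [shift, Finset.map_insert]
    exact Finset.insert_subset hx hS
  have h0 : shift p {0} ⊆ B := by simpa [shift] using hp
  obtain ⟨u, hu, a, ha, hla, haB, haS⟩ := grow {0} (by simp) h0 (by simp)
  rw [Finset.mem_singleton] at hu
  subst hu
  rw [zero_add] at hla haB haS
  have h1 := hsub _ _ h0 haB
  have c1 := Finset.card_insert_of_notMem haS
  rw [Finset.card_singleton] at c1
  obtain ⟨u, hu, b, hb, hlb, hbB, hbS⟩ := grow _ (by simp) h1 (by omega)
  have h2 := hsub _ _ h1 hbB
  have c2 := Finset.card_insert_of_notMem hbS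
  obtain ⟨v, hv, c, hc, hlc, hcB, hcS⟩ := grow _ (by simp) h2 (by omega)
  have h3 := hsub _ _ h2 hcB
  have c3 := Finset.card_insert_of_notMem hcS
  have e1 : (insert (v + c) (insert (u + b) (insert a {0})) : Finset (ℤ × ℤ)) =
      {0, a, u + b, v + c} := by
    ext x
    simp only [Finset.mem_insert, Finset.mem_singleton]
    tauto
  refine ⟨p, {0, a, u + b, v + c}, growth_mem_tetrominoes a ha hla u ?_ b hb hlb v ?_ c hc hlc
    ?_, ?_⟩
  · simp only [Finset.mem_insert, Finset.mem_singleton] at hu ⊢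
    tauto
  · simp only [Finset.mem_insert, Finset.mem_singleton] at hv ⊢
    tauto
  · rw [← e1]
    omega
  · rw [← e1]
    refine (Finset.eq_of_subset_of_card_le h3 ?_).symm
    rw [shift, Finset.card_map]
    omega

theorem IsTetromino.exists_step {B : Finset (ℤ × ℤ)} {v : ℤ × ℤ}
    (h : IsTetromino (insert v B)) (hv : v ∉ B) : ∃ u ∈ B, ∃ e ∈ unitSteps, v = u + e := by
  obtain ⟨x, hx, y, hy, hyv, hxy⟩ := h.cutConnected {v} (by simp) (by simp) (by
    intro h'
    have := h.card_eq
    rw [← h', Finset.card_singleton] at this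
    omega)
  rw [Finset.mem_singleton] at hx hyv
  subst hx
  exact ⟨y, Finset.mem_of_mem_insert_of_ne hy hyv, hxy.symm.exists_step⟩

theorem shift_insert (p v : ℤ × ℤ) (T : Finset (ℤ × ℤ)) :
    shift p (insert v T) = insert (p + v) (shift p T) :=
  Finset.map_insert _ _ _

theorem shift_erase (p v : ℤ × ℤ) (T : Finset (ℤ × ℤ)) :
    shift p (T.erase v) = (shift p T).erase (p + v) :=
  Finset.map_erase _ _ _

theorem IsTetromino.exists_exchange {B : Finset (ℤ × ℤ)} (hB : IsTetromino B) :
    ∃ t ∈ B, ∀ v ∉ B, IsTetromino (insert v (B.erase t)) →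
      pairSum kingWeight (insert v (B.erase t)) < pairSum kingWeight B := by
  obtain ⟨p, T, hT, rfl⟩ := hB
  obtain ⟨t, ht, h⟩ := exists_exchange_of_mem_tetrominoes T hT
  refine ⟨p + t, by simpa [mem_shift] using ht, fun v hv hvT => ?_⟩
  obtain ⟨u, hu, e, he, rfl⟩ := hvT.exists_step (fun h' => hv (Finset.mem_of_mem_erase h'))
  have e1 : insert (u + e) ((shift p T).erase (p + t)) =
      shift p (insert (u - p + e) (T.erase t)) := by
    rw [shift_insert, shift_erase]
    congr 1
    abel
  have h6 := hvT.six_le_pairSum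
  rw [e1, pairSum_shift] at h6 ⊢
  rw [pairSum_shift]
  rw [← shift_erase, mem_shift] at hu
  refine h _ hu e he (fun h' => hv ?_) h6
  rw [mem_shift]
  convert h' using 1
  abel

theorem exists_erase_not_isTetromino {B : Finset (ℤ × ℤ)} (hB : B.card = 5) :
    ∃ x ∈ B, ¬ IsTetromino (B.erase x) := by
  by_contra! hcon
  obtain ⟨x, hx⟩ : B.Nonempty := Finset.card_pos.1 (by omega)
  obtain ⟨p, T, hT, hBT⟩ := hcon x hx
  have hxT : x ∉ shift p T := hBT ▸ Finset.notMem_erase x B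
  have hB' : B = insert x (shift p T) := by rw [← hBT, Finset.insert_erase hx]
  have herase : ∀ t ∈ T, B.erase (p + t) = insert x (shift p (T.erase t)) := by
    intro t ht
    rw [hB', shift_erase, Finset.erase_insert_of_ne]
    rintro rfl
    exact hxT (by simpa [mem_shift] using ht)
  have htet : ∀ t ∈ T, IsTetromino (insert x (shift p (T.erase t))) := by
    intro t ht
    rw [← herase t ht]
    refine hcon _ ?_
    rw [hB']
    exact Finset.mem_insert_of_mem (by simpa [mem_shift] using ht)
  have h0 := zero_mem_of_mem_tetrominoes T hT
  -- Erasing the origin serves only to show that x is adjacent to a cell of the tetromino, as the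
  -- finite check requires.
  obtain ⟨u, hu, e, he, rfl⟩ := (htet 0 h0).exists_step (fun h' => hxT (by
    rw [shift_erase] at h'
    exact Finset.mem_of_mem_erase h'))
  rw [mem_shift] at hu
  have e1 : u + e = p + (u - p + e) := by abel
  obtain ⟨t, ht, hlt⟩ := exists_erase_of_mem_tetrominoes T hT _ (Finset.mem_of_mem_erase hu) e he
    (fun h' => hxT (by rw [mem_shift]; convert h' using 1; abel))
  have h6 := (htet t ht).six_le_pairSum
  rw [e1, ← shift_insert, pairSum_shift] at h6
  omega

/-- The offset is recovered as the lexicographically least cell: p - q and q - p are both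
nonnegative. This prevents double counting of translates. -/
theorem shift_injOn {p q : ℤ × ℤ} {S T : Finset (ℤ × ℤ)} (hS : S ∈ tetrominoes)
    (hT : T ∈ tetrominoes) (h : shift p S = shift q T) : p = q ∧ S = T := by
  have h1 : p ∈ shift q T := by
    rw [← h, mem_shift, sub_self]
    exact zero_mem_of_mem_tetrominoes S hS
  have h2 : q ∈ shift p S := by
    rw [h, mem_shift, sub_self]
    exact zero_mem_of_mem_tetrominoes T hT
  have h3 := lexNonneg_of_mem_tetrominoes T hT _ (mem_shift.1 h1)
  have h4 := lexNonneg_of_mem_tetrominoes S hS _ (mem_shift.1 h2)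
  have hpq : p = q := by
    obtain ⟨a, b⟩ := p
    obtain ⟨c, d⟩ := q
    simp only [LexNonneg, Prod.mk_sub_mk] at h3 h4
    rw [Prod.mk.injEq]
    omega
  subst hpq
  exact ⟨rfl, Finset.map_injective _ h⟩

end Tetromino

end CutComplex

namespace CutComplex

/-! ### Transfer from the plane to the finite grid graph. -/

theorem induce_connected_iff {V : Type*} (G : SimpleGraph V) (A : Finset V) :
    (G.induce (A : Set V)).Connected ↔ A.Nonempty ∧ CutConnected G.Adj A := by
  classical
  constructor
  · intro h
    obtain ⟨a⟩ := h.nonempty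
    refine ⟨⟨a, a.2⟩, fun S hS ⟨x, hx⟩ hSA => ?_⟩
    obtain ⟨y, hy, hyS⟩ : ∃ y ∈ A, y ∉ S := by
      by_contra! hcon
      exact hSA (hS.antisymm hcon)
    obtain ⟨w⟩ := h.preconnected ⟨x, hS hx⟩ ⟨y, hy⟩
    obtain ⟨d, -, h1, h2⟩ := w.exists_boundary_dart {z | z.1 ∈ S} hx hyS
    exact ⟨d.fst, h1, d.snd, d.snd.2, h2, d.adj⟩
  · rintro ⟨⟨a, ha⟩, h⟩
    rw [SimpleGraph.connected_iff_exists_forall_reachable]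
    refine ⟨⟨a, ha⟩, ?_⟩
    by_contra! hcon
    obtain ⟨⟨b, hb⟩, hab⟩ := hcon
    -- The component of a: an edge leaving it would contradict its definition.
    let S := A.filter fun x => ∃ hx : x ∈ A,
      (G.induce (A : Set V)).Reachable ⟨a, ha⟩ ⟨x, hx⟩
    obtain ⟨x, hx, y, hy, hyS, hxy⟩ := h S (Finset.filter_subset _ _)
      ⟨a, Finset.mem_filter.2 ⟨ha, ha, SimpleGraph.Reachable.refl _⟩⟩ (by
        intro hSA
        rw [← hSA] at hb
        obtain ⟨-, _, hb'⟩ := Finset.mem_filter.1 hb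
        exact hab hb')
    obtain ⟨-, _, hxr⟩ := Finset.mem_filter.1 hx
    refine hyS (Finset.mem_filter.2 ⟨hy, hy, hxr.trans (SimpleGraph.Adj.reachable ?_)⟩)
    exact hxy

/-- The vertices of the grid graph as points of the plane. -/
def cell (m n : ℕ) : (Fin m ×ₗ Fin n) ↪ ℤ × ℤ where
  toFun v := (((ofLex v).1 : ℕ), ((ofLex v).2 : ℕ))
  inj' := by
    intro v w h
    simp only [Prod.mk.injEq, Nat.cast_inj, Fin.val_inj] at h
    exact ofLex.injective (Prod.ext h.1 h.2)

theorem cell_apply {m n : ℕ} (v : Fin m ×ₗ Fin n) :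
    cell m n v = ((((ofLex v).1 : ℕ) : ℤ), (((ofLex v).2 : ℕ) : ℤ)) := rfl

theorem gridAdj_cell (m n : ℕ) (v w : Fin m ×ₗ Fin n) :
    gridAdj (cell m n v) (cell m n w) ↔ (gridGraph m n).Adj v w := by
  simp only [gridGraph, SimpleGraph.comap_adj, SimpleGraph.boxProd_adj, SimpleGraph.pathGraph_adj,
    gridAdj, cell_apply, Fin.ext_iff]
  omega

theorem mem_connectedSubsets_gridGraph {m n : ℕ} {A : Finset (Fin m ×ₗ Fin n)} :
    A ∈ connectedSubsets (gridGraph m n) 4 ↔ IsTetromino (A.map (cell m n)) := by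
  have hcut := cutConnected_map (cell m n) (gridAdj_cell m n) A
  constructor
  · rintro ⟨hA, h⟩
    exact isTetromino_of_cutConnected (by rwa [Finset.card_map])
      (hcut.2 ((induce_connected_iff _ A).1 h).2)
  · intro h
    have hA := h.card_eq
    rw [Finset.card_map] at hA
    exact ⟨hA, (induce_connected_iff _ A).2
      ⟨Finset.card_pos.1 (by omega), hcut.1 h.cutConnected⟩⟩

theorem exists_subset_not_connected_gridGraph {m n : ℕ} (B : Finset (Fin m ×ₗ Fin n))
    (hB : B.card = 4 + 1) :
    ∃ A ⊆ B, A.card = 4 ∧ ¬ ((gridGraph m n).induce (A : Set (Fin m ×ₗ Fin n))).Connected := by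
  obtain ⟨x, hx, hxB⟩ := exists_erase_not_isTetromino (B := B.map (cell m n))
    (by rwa [Finset.card_map])
  obtain ⟨v, hv, rfl⟩ := Finset.mem_map.1 hx
  have hcard : (B.erase v).card = 4 := by rw [Finset.card_erase_of_mem hv, hB]
  refine ⟨B.erase v, Finset.erase_subset _ _, hcard, fun h => hxB ?_⟩
  rw [← Finset.map_erase]
  exact mem_connectedSubsets_gridGraph.1 ⟨hcard, h⟩

theorem exists_exchange_gridGraph {m n : ℕ} (A : Finset (Fin m ×ₗ Fin n))
    (hA : A ∈ connectedSubsets (gridGraph m n) 4) : ∃ t ∈ A, ∀ v ∉ A,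
      insert v (A.erase t) ∈ connectedSubsets (gridGraph m n) 4 →
      pairSum kingWeight ((insert v (A.erase t)).map (cell m n)) <
        pairSum kingWeight (A.map (cell m n)) := by
  obtain ⟨x, hx, h⟩ := (mem_connectedSubsets_gridGraph.1 hA).exists_exchange
  obtain ⟨t, ht, rfl⟩ := Finset.mem_map.1 hx
  refine ⟨t, ht, fun v hv hvA => ?_⟩
  rw [mem_connectedSubsets_gridGraph] at hvA
  rw [Finset.map_insert, Finset.map_erase] at hvA ⊢
  exact h _ (by simpa using hv) hvA

/-! ### Counting the connected 4-sets of the grid. -/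

/-- The translations that move `T` into the `m` by `n` rectangle, if the origin is the
lexicographically least cell of `T`. -/
noncomputable def positions (m n : ℕ) (T : Finset (ℤ × ℤ)) : Finset (ℤ × ℤ) :=
  Finset.Ico 0 ((m : ℤ) - (T.sup fun x => x.1.toNat : ℕ)) ×ˢ
    Finset.Ico ((T.sup fun x => (-x.2).toNat : ℕ) : ℤ) ((n : ℤ) - (T.sup fun x => x.2.toNat : ℕ))

theorem card_positions (m n : ℕ) (T : Finset (ℤ × ℤ)) :
    (positions m n T).card = (m - T.sup fun x => x.1.toNat) *
      (n - ((T.sup fun x => (-x.2).toNat) + T.sup fun x => x.2.toNat)) := by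
  rw [positions, Finset.card_product, Int.card_Ico, Int.card_Ico]
  congr 1 <;> omega

/-- As the origin is the lexicographically least cell, no first coordinate is negative; only the
second needs a bound on both sides. -/
theorem mem_positions {m n : ℕ} {T : Finset (ℤ × ℤ)} (h0 : (0 : ℤ × ℤ) ∈ T)
    (hlex : ∀ x ∈ T, LexNonneg x) {p : ℤ × ℤ} :
    p ∈ positions m n T ↔
      ∀ x ∈ shift p T, (0 ≤ x.1 ∧ x.1 < m) ∧ 0 ≤ x.2 ∧ x.2 < n := by
  have hne : T.Nonempty := ⟨0, h0⟩
  rw [positions, Finset.mem_product, Finset.mem_Ico, Finset.mem_Ico]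
  constructor
  · rintro ⟨⟨h1, h2⟩, h3, h4⟩ x hx
    rw [mem_shift] at hx
    have hl := hlex _ hx
    have g1 := Finset.le_sup (f := fun x : ℤ × ℤ => x.1.toNat) hx
    have g2 := Finset.le_sup (f := fun x : ℤ × ℤ => (-x.2).toNat) hx
    have g3 := Finset.le_sup (f := fun x : ℤ × ℤ => x.2.toNat) hx
    simp only [LexNonneg, Prod.fst_sub, Prod.snd_sub] at g1 g2 g3 hl
    omega
  · intro h
    have hp : ∀ x ∈ T, (0 ≤ p.1 + x.1 ∧ p.1 + x.1 < m) ∧ 0 ≤ p.2 + x.2 ∧ p.2 + x.2 < n :=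
      fun x hx => h (p + x) (by simpa [mem_shift] using hx)
    obtain ⟨x, hx, hx'⟩ := Finset.exists_mem_eq_sup T hne fun x : ℤ × ℤ => x.1.toNat
    obtain ⟨y, hy, hy'⟩ := Finset.exists_mem_eq_sup T hne fun x : ℤ × ℤ => (-x.2).toNat
    obtain ⟨z, hz, hz'⟩ := Finset.exists_mem_eq_sup T hne fun x : ℤ × ℤ => x.2.toNat
    rw [hx', hy', hz']
    have a0 := hp 0 h0
    have a1 := hp x hx
    have a2 := hp y hy
    have a3 := hp z hz
    simp only [Prod.fst_zero, Prod.snd_zero] at a0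
    omega

theorem exists_map_cell_eq_iff {m n : ℕ} {B : Finset (ℤ × ℤ)} :
    (∃ A : Finset (Fin m ×ₗ Fin n), A.map (cell m n) = B) ↔
      ∀ x ∈ B, (0 ≤ x.1 ∧ x.1 < m) ∧ 0 ≤ x.2 ∧ x.2 < n := by
  constructor
  · rintro ⟨A, rfl⟩ x hx
    obtain ⟨v, -, rfl⟩ := Finset.mem_map.1 hx
    have h1 := (ofLex v).1.2
    have h2 := (ofLex v).2.2
    simp only [cell_apply]
    omega
  · intro h
    refine ⟨Finset.univ.filter fun v => cell m n v ∈ B, ?_⟩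
    ext x
    simp only [Finset.mem_map, Finset.mem_filter, Finset.mem_univ, true_and]
    constructor
    · rintro ⟨v, hv, rfl⟩
      exact hv
    · intro hx
      obtain ⟨⟨h1, h2⟩, h3, h4⟩ := h x hx
      have hv : cell m n (toLex (⟨x.1.toNat, by omega⟩, ⟨x.2.toNat, by omega⟩)) = x := by
        ext <;> simp [cell_apply, h1, h3]
      exact ⟨_, by rwa [hv], hv⟩

theorem ncard_connectedSubsets_gridGraph_eq_sum (m n : ℕ) :
    (connectedSubsets (gridGraph m n) 4).ncard = ∑ T ∈ tetrominoes, (positions m n T).card := by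
  have himage : Finset.map (cell m n) '' connectedSubsets (gridGraph m n) 4 =
      (((tetrominoes.sigma fun T => positions m n T).image fun a => shift a.2 a.1 :
        Finset (Finset (ℤ × ℤ))) : Set (Finset (ℤ × ℤ))) := by
    ext B
    simp only [Set.mem_image, mem_connectedSubsets_gridGraph, Finset.coe_image, Finset.mem_coe,
      Finset.mem_sigma, Sigma.exists]
    constructor
    · rintro ⟨A, ⟨p, T, hT, hAT⟩, rfl⟩
      refine ⟨T, p, ⟨hT, ?_⟩, hAT.symm⟩
      rw [mem_positions (zero_mem_of_mem_tetrominoes T hT) (lexNonneg_of_mem_tetrominoes T hT),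
        ← hAT]
      exact exists_map_cell_eq_iff.1 ⟨A, rfl⟩
    · rintro ⟨T, p, ⟨hT, hp⟩, rfl⟩
      rw [mem_positions (zero_mem_of_mem_tetrominoes T hT)
        (lexNonneg_of_mem_tetrominoes T hT)] at hp
      obtain ⟨A, hA⟩ := exists_map_cell_eq_iff.2 hp
      exact ⟨A, ⟨p, T, hT, hA⟩, hA⟩
  rw [← Set.ncard_image_of_injective _ (Finset.map_injective (cell m n)), himage,
    Set.ncard_coe_finset, Finset.card_image_of_injOn, Finset.card_sigma]
  rintro ⟨S, p⟩ hS ⟨T, q⟩ hT h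
  obtain ⟨rfl, rfl⟩ := shift_injOn (Finset.mem_sigma.1 hS).1 (Finset.mem_sigma.1 hT).1 h
  rfl

/-- Subtraction is truncated, so a tetromino too large for the rectangle contributes 0. For m = 2
this kills m - 3, whence the separate formula in that case. -/
theorem ncard_connectedSubsets_gridGraph (m n : ℕ) :
    (connectedSubsets (gridGraph m n) 4).ncard =
      (m - 1) * (n - 1) + m * (n - 3) + (m - 3) * n +
        8 * ((m - 1) * (n - 2)) + 8 * ((m - 2) * (n - 1)) := by
  have h := congrArg (fun l => (l.map fun a : ℕ × ℕ => (m - a.1) * (n - a.2)).sum)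
    extents_tetrominoList
  rw [ncard_connectedSubsets_gridGraph_eq_sum, tetrominoes,
    List.sum_toFinset _ nodup_tetrominoList]
  simp only [card_positions]
  rw [List.map_map] at h
  refine Eq.trans h ?_
  simp only [List.map_cons, List.map_nil, List.sum_cons, List.sum_nil]
  rw [Nat.sub_zero, Nat.sub_zero]
  ring

theorem ncard_connectedSubsets_gridGraph_two {n : ℕ} (hn : 3 ≤ n) :
    ((connectedSubsets (gridGraph 2 n) 4).ncard : ℤ) = 11 * n - 23 := by
  obtain ⟨b, rfl⟩ := Nat.exists_eq_add_of_le' hn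
  rw [ncard_connectedSubsets_gridGraph]
  simp only [Nat.add_sub_cancel, show b + 3 - 1 = b + 2 by omega, show b + 3 - 2 = b + 1 by omega]
  push_cast
  ring

theorem ncard_connectedSubsets_gridGraph_of_three_le {m n : ℕ} (hm : 3 ≤ m) (hn : 3 ≤ n) :
    ((connectedSubsets (gridGraph m n) 4).ncard : ℤ) = 19 * m * n - 28 * (m + n) + 33 := by
  obtain ⟨a, rfl⟩ := Nat.exists_eq_add_of_le' hm
  obtain ⟨b, rfl⟩ := Nat.exists_eq_add_of_le' hn
  rw [ncard_connectedSubsets_gridGraph]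
  simp only [Nat.add_sub_cancel, show b + 3 - 1 = b + 2 by omega, show b + 3 - 2 = b + 1 by omega,
    show a + 3 - 1 = a + 2 by omega, show a + 3 - 2 = a + 1 by omega]
  push_cast
  ring

/-! ### Specialising the general results to the grid graph. -/

theorem card_gridVertices (m n : ℕ) : Fintype.card (Fin m ×ₗ Fin n) = m * n := by
  simp [Lex]

theorem reducedEulerChar_cutComplex_gridGraph {m n : ℕ} (h : 5 ≤ m * n) :
    (-1 : ℤ) ^ (m * n - 5) * reducedEulerChar (cutComplex (gridGraph m n) 4) =
      ((m * n - 1).choose 3 : ℤ) - (connectedSubsets (gridGraph m n) 4).ncard := by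
  have := reducedEulerChar_cutComplex (k := 3) (G := gridGraph m n)
    exists_subset_not_connected_gridGraph (by rwa [card_gridVertices])
  rwa [card_gridVertices] at this

theorem ncard_facets_cutComplex_gridGraph (m n : ℕ) :
    ((facets (cutComplex (gridGraph m n) 4)).ncard : ℤ) =
      ((m * n).choose 4 : ℤ) - (connectedSubsets (gridGraph m n) 4).ncard := by
  rw [ncard_facets_cutComplex, card_gridVertices]

theorem subsingleton_reducedHomology_gridGraph {m n : ℕ} (hm : 1 ≤ m) (hn : 1 ≤ n) {d : ℤ}
    (hd : d ≠ (m : ℤ) * n - 5) :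
    Subsingleton (ReducedHomology (cutComplex (gridGraph m n) 4) d) := by
  have : Nonempty (Fin m ×ₗ Fin n) := ⟨toLex (⟨0, hm⟩, ⟨0, hn⟩)⟩
  refine subsingleton_reducedHomology (cycles_le_boundaries_cutComplex
    (fun A => pairSum kingWeight (A.map (cell m n))) exists_subset_not_connected_gridGraph
    exists_exchange_gridGraph d ?_)
  rw [card_gridVertices]
  push_cast
  intro h
  exact hd (by linarith)

theorem isTorsionFree_reducedHomology_gridGraph {m n : ℕ} (hm : 1 ≤ m) (hn : 1 ≤ n) (d : ℤ) :
    Module.IsTorsionFree ℤ (ReducedHomology (cutComplex (gridGraph m n) 4) d) := by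
  by_cases hd : d = (m : ℤ) * n - 5
  · refine isTorsionFree_reducedHomology (chains_cutComplex_eq_bot
      exists_subset_not_connected_gridGraph ?_)
    rw [card_gridVertices, hd]
    push_cast
    linarith
  · have := subsingleton_reducedHomology_gridGraph hm hn hd
    infer_instance

end CutComplex

open CutComplex
theorem mainTheorem7 (m n : ℕ) (hm : 1 ≤ m) (hn : 1 ≤ n) :
    (∀ d : ℤ, Module.IsTorsionFree ℤ (ReducedHomology (cutComplex (gridGraph m n) 4) d)) ∧
    (∀ d : ℤ, d ≠ (m : ℤ) * n - 5 → d ≠ (m : ℤ) * n - 6 →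
      Subsingleton (ReducedHomology (cutComplex (gridGraph m n) 4) d)) ∧
    (m = 2 ∧ 3 ≤ n →
      ((connectedSubsets (gridGraph m n) 4).ncard : ℤ) = 11 * n - 23 ∧
      (-1 : ℤ) ^ (m * n - 5) * reducedEulerChar (cutComplex (gridGraph m n) 4) =
        ((m * n - 1).choose 3 : ℤ) - (11 * n - 23) ∧
      ((facets (cutComplex (gridGraph m n) 4)).ncard : ℤ) =
        ((m * n).choose 4 : ℤ) - (11 * n - 23)) ∧
    (3 ≤ m ∧ 3 ≤ n →
      ((connectedSubsets (gridGraph m n) 4).ncard : ℤ) = 19 * m * n - 28 * (m + n) + 33 ∧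
      (-1 : ℤ) ^ (m * n - 5) * reducedEulerChar (cutComplex (gridGraph m n) 4) =
        ((m * n - 1).choose 3 : ℤ) - (19 * m * n - 28 * (m + n) + 33) ∧
      ((facets (cutComplex (gridGraph m n) 4)).ncard : ℤ) =
        ((m * n).choose 4 : ℤ) - (19 * m * n - 28 * (m + n) + 33)) := by
  refine ⟨isTorsionFree_reducedHomology_gridGraph hm hn,
    fun d hd _ => subsingleton_reducedHomology_gridGraph hm hn hd, ?_, ?_⟩
  · rintro ⟨rfl, hn3⟩
    have hc := ncard_connectedSubsets_gridGraph_two hn3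
    refine ⟨hc, ?_, ?_⟩
    · rw [reducedEulerChar_cutComplex_gridGraph (by omega), hc]
    · rw [ncard_facets_cutComplex_gridGraph, hc]
  · rintro ⟨hm3, hn3⟩
    have hc := ncard_connectedSubsets_gridGraph_of_three_le hm3 hn3
    refine ⟨hc, ?_, ?_⟩
    · rw [reducedEulerChar_cutComplex_gridGraph (by nlinarith), hc]
    · rw [ncard_facets_cutComplex_gridGraph, hc]
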